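/- Let $K$ be a commutative ring with unit and let $A$, $B$, $C$ be commutative unital $K$-algebras. For a $K$-linear map $\varphi\colon A\to B$ define the Frobenius maps $F_k(\varphi,\cdot)\colon A^k\to B$, $k\ge 1$, by $F_1(\varphi,a)=\varphi(a)$ and $$F_{k+1}(\varphi,a_1,\dots,a_{k+1})=\varphi(a_1)\,F_k(\varphi,a_2,\dots,a_{k+1})-\sum_{i=2}^{k+1}F_k(\varphi,a_2,\dots,a_{i-1},a_1a_i,a_{i+1},\dots,a_{k+1}).$$ For an integer $n\ge 1$, $\varphi$ is called an $n$-homomorphism if $\varphi(1)=n$ and $F_{n+1}(\varphi,a_1,\dots,a_{n+1})=0$ for all $a_1,\dots,a_{n+1}\in A$. Theorem. Let $n,m\ge 1$ be integers. (1) If $f\colon A\to B$ is an $n$-homomorphism and $g\colon A\to B$ is an $m$-homomorphism, then $f+g$ is an $(n+m)$-homomorphism. (2) If $f\colon A\to B$ is an $n$-homomorphism and $g\colon B\to C$ is an $m$-homomorphism, then $g\circ f\colon A\to C$ is an $nm$-homomorphism. -/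

import Mathlib

/-- The Frobenius maps `F_k(φ, a₁, …, a_k)` of a linear map `φ : A → B` of commutative algebras:
`F_1(φ, a) = φ(a)` and
`F_{k+1}(φ, a₁, …, a_{k+1}) = φ(a₁) F_k(φ, a₂, …, a_{k+1})
  - F_k(φ, a₁a₂, a₃, …, a_{k+1}) - … - F_k(φ, a₂, …, a_k, a₁a_{k+1})`.
The recursion is started with the convention `F_0 = 1`, which gives `F_1(φ, a) = φ(a)`
(see `frobeniusMap_one`). The arguments are indexed by `Fin k`, and `Fin.tail a` is
`(a₂, …, a_{k+1})`. -/
def frobeniusMap {K A B : Type*} [CommRing K] [CommRing A] [Algebra K A] [CommRing B] [Algebra K B]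
    (φ : A →ₗ[K] B) : (k : ℕ) → (Fin k → A) → B
  | 0, _ => 1
  | k + 1, a =>
      φ (a 0) * frobeniusMap φ k (Fin.tail a)
        - ∑ i : Fin k, frobeniusMap φ k (Function.update (Fin.tail a) i (a 0 * Fin.tail a i))

theorem frobeniusMap_one {K A B : Type*} [CommRing K] [CommRing A] [Algebra K A] [CommRing B]
    [Algebra K B] (φ : A →ₗ[K] B) (a : Fin 1 → A) : frobeniusMap φ 1 a = φ (a 0) := by
  simp [frobeniusMap]

/-- A linear map `φ : A → B` is an `n`-homomorphism if `φ(1) = n` and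
`F_{n+1}(φ, a₁, …, a_{n+1}) = 0` for all `a₁, …, a_{n+1}` in `A`. -/
structure IsNHomomorphism {K A B : Type*} [CommRing K] [CommRing A] [Algebra K A] [CommRing B]
    [Algebra K B] (n : ℕ) (φ : A →ₗ[K] B) : Prop where
  map_one : φ 1 = (n : B)
  frobeniusMap_eq_zero : ∀ a : Fin (n + 1) → A, frobeniusMap φ (n + 1) a = 0

/-! Two expansions carry both claims. `frobeniusList_add`: `F(f + g, l)` is the sum of `F(f, S) F(g,
T)` over all splittings of `l` into `S` and `T`. `frobeniusList_comp`: `F(g ∘ f, l)` is the sum over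
set partitions of `l` of `F(g, ·)` evaluated at the values `F(f, b)` on the blocks `b`. The rest is
pigeonhole. Among `n + m + 1` arguments, `S` exceeds `n` or `T` exceeds `m`. Among `nm + 1`, some
block exceeds `n`, giving `F(g, ·)` a zero entry, or there are more than `m` blocks. Both expansions
follow by induction from the recursion, because multiplying one entry by `a` (`varyOne`) is
compatible with splitting and partitioning. -/

/-! ### Varying one entry of a list -/

/-- The multiset of lists obtained from a list by replacing a single entry `b` by a member
of `d b`. -/
def varyOne {α : Type*} (d : α → Multiset α) : List α → Multiset (List α)
  | [] => 0
  | b :: l => (d b).map (· :: l) + (varyOne d l).map (b :: ·)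

theorem length_eq_of_mem_varyOne {α : Type*} (d : α → Multiset α) (l : List α) :
    ∀ l' ∈ varyOne d l, l'.length = l.length := by
  induction l with
  | nil => simp [varyOne]
  | cons b l ih =>
    intro l' h
    simp only [varyOne, Multiset.mem_add, Multiset.mem_map] at h
    rcases h with ⟨c, -, rfl⟩ | ⟨c, hc, rfl⟩
    · simp
    · simp [ih c hc]

theorem varyOne_append_cons {α : Type*} (d : α → Multiset α) (l₁ l₂ : List α) (z : α) :
    varyOne d (l₁ ++ z :: l₂) = (varyOne d l₁).map (· ++ z :: l₂)
      + (d z).map (fun w => l₁ ++ w :: l₂) + (varyOne d l₂).map (fun l => l₁ ++ z :: l) := by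
  induction l₁ with
  | nil => simp [varyOne]
  | cons b l ih => simp [varyOne, ih, add_assoc]

/-- `varyOne` behaves like a derivation: changes at different positions commute, so only the
one-entry commutator `c` survives. -/
theorem varyOne_bind_comm {α : Type*} (d e c : α → Multiset α)
    (h : ∀ b, (e b).bind d = (d b).bind e + c b) (l : List α) :
    (varyOne e l).bind (varyOne d) = (varyOne d l).bind (varyOne e) + varyOne c l := by
  induction l with
  | nil => simp [varyOne]
  | cons b l ih =>
    have key : ∀ d e : α → Multiset α, (varyOne e (b :: l)).bind (varyOne d) =
        ((e b).bind d).map (· :: l) + (e b).bind (fun x => (varyOne d l).map (x :: ·))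
        + ((varyOne e l).bind (fun l' => (d b).map (· :: l'))
        + ((varyOne e l).bind (varyOne d)).map (b :: ·)) := by
      intro d e
      simp only [varyOne, Multiset.add_bind, Multiset.bind_map, Multiset.bind_add,
        Multiset.map_bind]
    have swap : ∀ d e : α → Multiset α, (e b).bind (fun x => (varyOne d l).map (x :: ·)) =
        (varyOne d l).bind (fun l' => (e b).map (· :: l')) :=
      fun d e => Multiset.bind_map_comm _ _
    rw [key, key, ih, h, swap d e, swap e d]
    simp only [varyOne, Multiset.map_add]
    abel

theorem sum_map_varyOne_singleton {α M : Type*} [AddCommMonoid M] (h : α → α) (l : List α)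
    (G : List α → M) : ((varyOne (fun b => {h b}) l).map G).sum =
      ∑ i : Fin l.length, G (l.set i (h (l.get i))) := by
  induction l generalizing G with
  | nil => simp [varyOne]
  | cons b l ih =>
    simp only [varyOne, Multiset.map_add, Multiset.sum_add, Multiset.map_map, List.length_cons,
      Fin.sum_univ_succ]
    rw [show (G ∘ fun x => b :: x) = fun x => G (b :: x) from rfl, ih fun x => G (b :: x)]
    simp

/-! ### Frobenius maps on lists -/

/-- The Frobenius maps with arguments given as a list. -/
def frobeniusList {K A B : Type*} [CommRing K] [CommRing A] [Algebra K A] [CommRing B]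
    [Algebra K B] (φ : A →ₗ[K] B) (l : List A) : B :=
  frobeniusMap φ l.length l.get

section

variable {K A B C : Type*} [CommRing K] [CommRing A] [Algebra K A] [CommRing B] [Algebra K B]
  [CommRing C] [Algebra K C]

theorem frobeniusList_ofFn (φ : A →ₗ[K] B) {k : ℕ} (a : Fin k → A) :
    frobeniusList φ (List.ofFn a) = frobeniusMap φ k a :=
  congrArg (fun p : Σ k, Fin k → A => frobeniusMap φ p.1 p.2)
    (List.equivSigmaTuple.right_inv ⟨k, a⟩)

theorem frobeniusList_nil (φ : A →ₗ[K] B) : frobeniusList φ [] = 1 := rfl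

theorem frobeniusList_cons (φ : A →ₗ[K] B) (a : A) (l : List A) :
    frobeniusList φ (a :: l) = φ a * frobeniusList φ l
      - ((varyOne (fun b => {a * b}) l).map (frobeniusList φ)).sum := by
  rw [sum_map_varyOne_singleton]
  have h : ∀ i : Fin l.length, frobeniusList φ (l.set i (a * l.get i)) =
      frobeniusMap φ l.length (Function.update l.get i (a * l.get i)) := by
    intro i
    rw [← frobeniusList_ofFn]
    congr 1
    refine List.ext_getElem (by simp) fun j h₁ h₂ => ?_
    simp only [List.getElem_set, List.getElem_ofFn, Function.update_apply, Fin.ext_iff,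
      List.get_eq_getElem, eq_comm]
  simp only [h]
  rfl

/-- Every term of the recursion for `F_{k+1}` contains a value of `F_k`, so vanishing propagates
upwards. -/
theorem frobeniusList_eq_zero {n : ℕ} {φ : A →ₗ[K] B} (h : IsNHomomorphism n φ) (l : List A)
    (hl : n < l.length) : frobeniusList φ l = 0 := by
  have H : ∀ k, n + 1 ≤ k → ∀ a : Fin k → A, frobeniusMap φ k a = 0 := by
    intro k hk
    induction k, hk using Nat.le_induction with
    | base => exact h.frobeniusMap_eq_zero
    | succ k _ ih => intro a; simp [frobeniusMap, ih]
  exact H _ hl _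

/-- A function on lists which is additive in every entry. -/
def IsMultiadditive {M N : Type*} [Add M] [Add N] (H : List M → N) : Prop :=
  ∀ l₁ l₂ x y, H (l₁ ++ (x + y) :: l₂) = H (l₁ ++ x :: l₂) + H (l₁ ++ y :: l₂)

theorem IsMultiadditive.cons {M N : Type*} [Add M] [Add N] {H : List M → N}
    (h : IsMultiadditive H) (b : M) : IsMultiadditive fun l => H (b :: l) :=
  fun l₁ => h (b :: l₁)

theorem IsMultiadditive.eq_zero {M N : Type*} [AddGroup M] [AddGroup N] {H : List M → N}
    (h : IsMultiadditive H) {l : List M} (hl : 0 ∈ l) : H l = 0 := by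
  obtain ⟨l₁, l₂, rfl⟩ := List.append_of_mem hl
  simpa using h l₁ l₂ 0 0

theorem IsMultiadditive.sub_sum {M N : Type*} [AddCommGroup M] [AddCommGroup N] {H : List M → N}
    (h : IsMultiadditive H) (l : List M) (x : M) (s : Multiset M) :
    H ((x - s.sum) :: l) = H (x :: l) - (s.map fun y => H (y :: l)).sum := by
  let T : M →+ N := AddMonoidHom.mk' (fun y => H (y :: l)) (h [] l)
  have := map_sub T x s.sum
  rw [map_multiset_sum] at this
  exact this

/-- Strong induction on length: in each term of the recursion the sum `x + y` is under `φ` or is an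
entry, possibly multiplied, of a shorter list. -/
theorem frobeniusList_isMultiadditive (φ : A →ₗ[K] B) : IsMultiadditive (frobeniusList φ) := by
  suffices H : ∀ n, ∀ l₁ l₂ : List A, l₁.length + l₂.length = n → ∀ x y,
      frobeniusList φ (l₁ ++ (x + y) :: l₂) =
        frobeniusList φ (l₁ ++ x :: l₂) + frobeniusList φ (l₁ ++ y :: l₂) from
    fun l₁ l₂ => H _ l₁ l₂ rfl
  intro n
  induction n using Nat.strong_induction_on with
  | _ n ih =>
    rintro (_ | ⟨c, l₁⟩) l₂ hn x y
    · simp only [List.nil_append, frobeniusList_cons, sum_map_varyOne_singleton, map_add,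
        add_mul]
      have : ∀ i : Fin l₂.length, frobeniusList φ (l₂.set i (x * l₂.get i + y * l₂.get i)) =
          frobeniusList φ (l₂.set i (x * l₂.get i))
            + frobeniusList φ (l₂.set i (y * l₂.get i)) := by
        intro i
        have hi := i.2
        simp only [List.length_nil] at hn
        simp only [List.set_eq_take_append_cons_drop, hi, if_true]
        refine ih (l₂.length - 1) (by omega) _ _ ?_ _ _
        simp only [List.length_take, List.length_drop]
        omega
      simp only [this, Finset.sum_add_distrib]
      ring
    · simp only [List.length_cons] at hn
      simp only [List.cons_append, frobeniusList_cons, varyOne_append_cons, Multiset.map_add,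
        Multiset.sum_add, Multiset.map_map, Function.comp_def, Multiset.map_singleton,
        Multiset.sum_singleton, mul_add]
      rw [ih _ (by omega) l₁ l₂ rfl, ih _ (by omega) l₁ l₂ rfl,
        Multiset.map_congr rfl fun l hl => ih (n - 1) (by omega) l l₂
          (by rw [length_eq_of_mem_varyOne _ _ l hl]; omega) x y,
        Multiset.map_congr rfl fun l hl => ih (n - 1) (by omega) l₁ l
          (by rw [length_eq_of_mem_varyOne _ _ l hl]; omega) x y,
        Multiset.sum_map_add, Multiset.sum_map_add]
      ring

/-! ### Splittings and sums -/

/-- The multiset of all ways to distribute the entries of a list between two lists. -/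
def splittings {α : Type*} : List α → Multiset (List α × List α)
  | [] => {([], [])}
  | a :: l => (splittings l).map (fun p => (a :: p.1, p.2))
      + (splittings l).map (fun p => (p.1, a :: p.2))

theorem length_add_length_of_mem_splittings {α : Type*} (l : List α) :
    ∀ p ∈ splittings l, p.1.length + p.2.length = l.length := by
  induction l with
  | nil => simp [splittings]
  | cons a l ih =>
    intro p hp
    simp only [splittings, Multiset.mem_add, Multiset.mem_map] at hp
    rcases hp with ⟨q, hq, rfl⟩ | ⟨q, hq, rfl⟩ <;>
      · have := ih q hq
        simp only [List.length_cons]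
        omega

theorem varyOne_bind_splittings {α : Type*} (d : α → Multiset α) (l : List α) :
    (varyOne d l).bind splittings = (splittings l).bind fun p =>
      (varyOne d p.1).map (fun s => (s, p.2)) + (varyOne d p.2).map (fun t => (p.1, t)) := by
  induction l with
  | nil => simp [splittings, varyOne]
  | cons a l ih =>
    have h₁ := congrArg (Multiset.map fun p : List α × List α => (a :: p.1, p.2)) ih
    have h₂ := congrArg (Multiset.map fun p : List α × List α => (p.1, a :: p.2)) ih
    simp only [Multiset.map_bind, Multiset.map_add, Multiset.map_map, Function.comp_def,
      Multiset.bind_add] at h₁ h₂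
    simp only [varyOne, splittings, Multiset.add_bind, Multiset.bind_map, Multiset.bind_add,
      Multiset.map_add, Multiset.map_map, Function.comp_def, h₁, h₂,
      Multiset.bind_map_comm (d a)]
    abel

theorem frobeniusList_add (f g : A →ₗ[K] B) (l : List A) :
    frobeniusList (f + g) l =
      ((splittings l).map fun p => frobeniusList f p.1 * frobeniusList g p.2).sum := by
  induction hn : l.length generalizing l with
  | zero =>
    obtain rfl := List.length_eq_zero_iff.mp hn
    simp [splittings, frobeniusList_nil]
  | succ n ih =>
    obtain _ | ⟨a, l⟩ := l
    · simp at hn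
    have hl : l.length = n := by simpa using hn
    rw [frobeniusList_cons, ih l hl, Multiset.map_congr rfl fun l' hl' =>
      ih l' ((length_eq_of_mem_varyOne _ _ l' hl').trans hl), ← Multiset.sum_bind,
      ← Multiset.map_bind, varyOne_bind_splittings]
    simp only [splittings, Multiset.map_bind, Multiset.sum_bind, Multiset.map_add,
      Multiset.sum_add, Multiset.map_map, Function.comp_def, frobeniusList_cons,
      Multiset.sum_map_mul_left, Multiset.sum_map_mul_right, Multiset.sum_map_add, sub_mul,
      mul_sub, Multiset.sum_map_sub, LinearMap.add_apply, add_mul, mul_assoc,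
      mul_left_comm _ (g a)]
    ring

/-! ### Set partitions and composition -/

/-- The multiset of all set partitions of the entries of a list, the blocks and the partitions
being written as lists. -/
def setPartitions {α : Type*} : List α → Multiset (List (List α))
  | [] => {[]}
  | a :: l => (setPartitions l).map ([a] :: ·)
      + (setPartitions l).bind (varyOne fun b => {a :: b})

theorem sum_length_of_mem_setPartitions {α : Type*} (l : List α) :
    ∀ P ∈ setPartitions l, (P.map List.length).sum = l.length := by
  have H : ∀ (a : α) (P : List (List α)), ∀ Q ∈ varyOne (fun b => {a :: b}) P,
      (Q.map List.length).sum = (P.map List.length).sum + 1 := by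
    intro a P
    induction P with
    | nil => simp [varyOne]
    | cons b P ih =>
      intro Q hQ
      simp only [varyOne, Multiset.mem_add, Multiset.mem_map, Multiset.mem_singleton] at hQ
      rcases hQ with ⟨_, rfl, rfl⟩ | ⟨R, hR, rfl⟩
      · simp only [List.map_cons, List.sum_cons, List.length_cons]
        omega
      · have := ih R hR
        simp only [List.map_cons, List.sum_cons]
        omega
  induction l with
  | nil => simp [setPartitions]
  | cons a l ih =>
    intro P hP
    simp only [setPartitions, Multiset.mem_add, Multiset.mem_map, Multiset.mem_bind] at hP
    rcases hP with ⟨Q, hQ, rfl⟩ | ⟨Q, hQ, hP⟩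
    · simp [ih Q hQ, add_comm]
    · rw [H a Q P hP, ih Q hQ, List.length_cons]

theorem varyOne_bind_setPartitions {α : Type*} (h : α → α) (l : List α) :
    (varyOne (fun b => {h b}) l).bind setPartitions =
      (setPartitions l).bind (varyOne (varyOne fun b => {h b})) := by
  induction l with
  | nil => simp [setPartitions, varyOne]
  | cons a l ih =>
    -- Varying an entry of `a :: b` changes either `b` or the new head; the latter is the commutator
    -- term `h a :: b`.
    have comm := varyOne_bind_comm (varyOne fun b => {h b}) (fun b : List α => {a :: b})
      (fun b => {h a :: b}) (fun b => by
        simp [varyOne, Multiset.bind_singleton, add_comm])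
    have h₁ := congrArg (Multiset.map ([a] :: ·)) ih
    have h₂ := congrArg (fun s => s.bind (varyOne fun b => {a :: b})) ih
    simp only [Multiset.map_bind, Multiset.bind_assoc] at h₁ h₂
    simp only [varyOne, setPartitions, Multiset.add_bind, Multiset.bind_map, Multiset.bind_add,
      Multiset.map_singleton, Multiset.singleton_bind, Multiset.map_zero, add_zero,
      Multiset.bind_assoc, comm, h₁, h₂, Multiset.bind_singleton]
    abel

/-- Used with `v = F(f, ·)`, `e` inserting `a` into a block and `t` multiplication by `f a`; then
`h` is the recursion for `f`. -/
theorem IsMultiadditive.sum_map_varyOne {α M N : Type*} [AddCommGroup M] [AddCommGroup N]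
    {H : List M → N} (hH : IsMultiadditive H) (v : α → M) (e : α → α) (t : M → M)
    (d : α → Multiset α) (h : ∀ b, v (e b) = t (v b) - ((d b).map v).sum) (P : List α) :
    ((varyOne (fun b => {e b}) P).map fun Q => H (Q.map v)).sum =
      ((varyOne (fun b => {t b}) (P.map v)).map H).sum
        - ((varyOne d P).map fun Q => H (Q.map v)).sum := by
  induction P generalizing H with
  | nil => simp [varyOne]
  | cons b P ih =>
    have := ih (hH.cons (v b))
    simp only [varyOne, Multiset.map_add, Multiset.sum_add, Multiset.map_map, Function.comp_def,
      Multiset.map_singleton, Multiset.sum_singleton, List.map_cons, this, h, hH.sub_sum]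
    abel

theorem frobeniusList_comp (f : A →ₗ[K] B) (g : B →ₗ[K] C) (l : List A) :
    frobeniusList (g ∘ₗ f) l =
      ((setPartitions l).map fun P => frobeniusList g (P.map (frobeniusList f))).sum := by
  induction hn : l.length generalizing l with
  | zero =>
    obtain rfl := List.length_eq_zero_iff.mp hn
    simp [setPartitions, frobeniusList_nil]
  | succ n ih =>
    obtain _ | ⟨a, l⟩ := l
    · simp at hn
    have hl : l.length = n := by simpa using hn
    have key := (frobeniusList_isMultiadditive g).sum_map_varyOne (frobeniusList f) (a :: ·)
      (f a * ·) (varyOne fun b => {a * b}) (frobeniusList_cons f a)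
    rw [frobeniusList_cons, ih l hl, Multiset.map_congr rfl fun l' hl' =>
      ih l' ((length_eq_of_mem_varyOne _ _ l' hl').trans hl), ← Multiset.sum_bind,
      ← Multiset.map_bind, varyOne_bind_setPartitions]
    have single : frobeniusList f [a] = f a := by
      simp [frobeniusList_cons, frobeniusList_nil, varyOne]
    -- The terms with `f a` multiplied into a block value cancel: they come with a minus sign from
    -- the block `[a]` and a plus sign from `key`.
    simp only [setPartitions, Multiset.map_bind, Multiset.sum_bind, Multiset.map_add,
      Multiset.sum_add, Multiset.map_map, Function.comp_def, List.map_cons, single,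
      frobeniusList_cons g (f a), key, Multiset.sum_map_sub, Multiset.sum_map_mul_left,
      LinearMap.comp_apply]
    ring

theorem IsNHomomorphism.add {n m : ℕ} {f g : A →ₗ[K] B} (hf : IsNHomomorphism n f)
    (hg : IsNHomomorphism m g) : IsNHomomorphism (n + m) (f + g) where
  map_one := by simp [hf.map_one, hg.map_one]
  frobeniusMap_eq_zero a := by
    rw [← frobeniusList_ofFn, frobeniusList_add]
    refine Multiset.sum_eq_zero fun x hx => ?_
    obtain ⟨p, hp, rfl⟩ := Multiset.mem_map.mp hx
    have := length_add_length_of_mem_splittings _ p hp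
    rw [List.length_ofFn] at this
    obtain h | h : n < p.1.length ∨ m < p.2.length := by omega
    · rw [frobeniusList_eq_zero hf _ h, zero_mul]
    · rw [frobeniusList_eq_zero hg _ h, mul_zero]

theorem IsNHomomorphism.comp {n m : ℕ} {f : A →ₗ[K] B} {g : B →ₗ[K] C}
    (hf : IsNHomomorphism n f) (hg : IsNHomomorphism m g) :
    IsNHomomorphism (n * m) (g ∘ₗ f) where
  map_one := by
    rw [LinearMap.comp_apply, hf.map_one, ← nsmul_one, map_nsmul, hg.map_one, nsmul_eq_mul,
      Nat.cast_mul]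
  frobeniusMap_eq_zero a := by
    rw [← frobeniusList_ofFn, frobeniusList_comp]
    refine Multiset.sum_eq_zero fun x hx => ?_
    obtain ⟨P, hP, rfl⟩ := Multiset.mem_map.mp hx
    have hs := sum_length_of_mem_setPartitions _ P hP
    rw [List.length_ofFn] at hs
    by_cases h : ∃ b ∈ P, n < b.length
    · obtain ⟨b, hb, h⟩ := h
      exact (frobeniusList_isMultiadditive g).eq_zero
        (List.mem_map.mpr ⟨b, hb, frobeniusList_eq_zero hf b h⟩)
    · push Not at h
      refine frobeniusList_eq_zero hg _ ?_
      -- With all blocks of size at most `n`, `nm + 1 ≤ n * P.length`, which forces more than `m`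
      -- blocks.
      have := List.sum_le_card_nsmul (P.map List.length) n (by simpa using h)
      rw [hs, List.length_map, smul_eq_mul, mul_comm P.length] at this
      rw [List.length_map]
      exact lt_of_mul_lt_mul_left (Nat.lt_of_succ_le this) (Nat.zero_le n)

end

theorem mainTheorem2 {K A B C : Type*} [CommRing K] [CommRing A] [Algebra K A]
    [CommRing B] [Algebra K B] [CommRing C] [Algebra K C]
    (n m : ℕ) (hn : 1 ≤ n) (hm : 1 ≤ m) :
    (∀ f g : A →ₗ[K] B, IsNHomomorphism n f → IsNHomomorphism m g →
      IsNHomomorphism (n + m) (f + g)) ∧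
    (∀ (f : A →ₗ[K] B) (g : B →ₗ[K] C), IsNHomomorphism n f → IsNHomomorphism m g →
      IsNHomomorphism (n * m) (g ∘ₗ f)) :=
  ⟨fun _ _ hf hg => hf.add hg, fun _ _ hf hg => hf.comp hg⟩
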